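/- Let $\mathbb F$ be an algebraically closed field of characteristic zero, $\mathbb V$ a finite-dimensional $\mathbb F$-vector space, $\mathfrak g=\mathfrak{gl}(\mathbb V)$, $m\ge 4$, and $\zeta\in\mathbb F$ a primitive $m$-th root of unity. Let $\theta$ be an inner automorphism of $\mathfrak g$ (conjugation by an element of $\mathrm{GL}(\mathbb V)$) of order $m$, and let $\mathfrak g_i=\{x\in\mathfrak g\mid\theta(x)=\zeta^i x\}$ for $i\in\mathbb Z/m\mathbb Z$, so that $\mathfrak g=\bigoplus_{i}\mathfrak g_i$. Let $G_0\subset\mathrm{GL}(\mathbb V)$ be the connected subgroup with Lie algebra $\mathfrak g_0$, acting on $\mathfrak g_1$ by conjugation. A Cartan subspace of $\mathfrak g_1$ is a maximal subspace of $\mathfrak g_1$ consisting of commuting semisimple elements; $\mathrm{rank}(G_0,\mathfrak g_1)$ is the common dimension of all Cartan subspaces. A multiplicities vector of $\theta$ is $\hat r=(r_0,\dots,r_{m-1})$ with $r_t=\dim\{v\in\mathbb V\mid gv=\zeta^t v\}$, where $g\in\mathrm{GL}(\mathbb V)$ satisfies $g^m=1$ and $\theta(x)=gxg^{-1}$ for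 all $x$; it is unique up to cyclic permutation, and its indices are read modulo $m$. For a Lie algebra $\mathfrak q$ and a finite-dimensional $\mathfrak q$-module $V$, set $\mathrm{ind}(\mathfrak q,V)=\dim V-\max_{\xi\in V^*}\dim(\mathfrak q\cdot\xi)$. If $\mathfrak q$ is the Lie algebra of an algebraic group $Q$ and $V$ is a $Q$-module, the pair $(Q,V)$ has good index behaviour (GIB) if for every $v\in V$ $$\mathrm{ind}(\mathfrak q,V^*)=\mathrm{ind}\bigl(\mathfrak q_v,(V/\mathfrak q\cdot v)^*\bigr),\qquad \mathfrak q_v=\{x\in\mathfrak q\mid x\cdot v=0\}.$$ Theorem. Suppose that either $\mathrm{rank}(G_0,\mathfrak g_1)>1$, or $\mathrm{rank}(G_0,\mathfrak g_1)=1$ and $\hat r$ contains three cyclically consecutive entries $r_i,r_{i+1},r_{i+2}$, all at least $2$. Then $(G_0,\mathfrak g_1)$ does not have GIB. -/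

import Mathlib

namespace ThetaRep

section Index

variable (K L M : Type*) [Field K] [LieRing L] [LieAlgebra K L]
  [AddCommGroup M] [Module K M] [LieRingModule L M] [LieModule K L M]

/-- The tangent space `L · v = {⁅x, v⁆ | x ∈ L}` of the orbit of `v`, as a subspace of `M`. -/
def tangent (v : M) : Submodule K M where
  carrier := {w | ∃ x : L, ⁅x, v⁆ = w}
  add_mem' := by
    rintro _ _ ⟨x, rfl⟩ ⟨y, rfl⟩
    exact ⟨x + y, add_lie x y v⟩
  zero_mem' := ⟨0, zero_lie v⟩
  smul_mem' := by
    rintro c _ ⟨x, rfl⟩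
    exact ⟨c • x, smul_lie c x v⟩

/-- The index of a finite-dimensional `L`-module `M`:
`ind(L, M) = dim M - max_{ξ ∈ M*} dim (L · ξ)`. -/
noncomputable def index : ℕ :=
  Module.finrank K M -
    ⨆ ξ : Module.Dual K M, Module.finrank K (tangent K L (Module.Dual K M) ξ)

variable {M}

/-- The stabiliser `L_v = {x ∈ L | ⁅x, v⁆ = 0}`. -/
def stabilizer (v : M) : LieSubalgebra K L where
  carrier := {x | ⁅x, v⁆ = 0}
  add_mem' := by
    intro x y hx hy
    simp only [Set.mem_ofPred_eq] at hx hy ⊢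
    rw [add_lie, hx, hy, add_zero]
  zero_mem' := zero_lie v
  smul_mem' := by
    intro c x hx
    simp only [Set.mem_ofPred_eq] at hx ⊢
    rw [smul_lie, hx, smul_zero]
  lie_mem' := by
    intro x y hx hy
    simp only [Set.mem_ofPred_eq] at hx hy ⊢
    change ⁅x, v⁆ = 0 at hx
    change ⁅y, v⁆ = 0 at hy
    rw [lie_lie, hx, hy, lie_zero, lie_zero, sub_zero]

/-- `L · v` is stable under `L_v`. -/
def tangentSubmodule (v : M) : LieSubmodule K (stabilizer K L v) M where
  __ := tangent K L M v
  lie_mem := by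
    rintro ⟨x, hx⟩ _ ⟨y, rfl⟩
    refine ⟨⁅x, y⁆, ?_⟩
    change ⁅x, v⁆ = 0 at hx
    change ⁅⁅x, y⁆, v⁆ = ⁅x, ⁅y, v⁆⁆
    rw [lie_lie, hx, lie_zero, sub_zero]

variable (M)

/-- Good index behaviour of the `L`-module `M`:
`ind(L, M*) = ind(L_v, (M / L · v)*)` for every `v ∈ M`. -/
def GIB : Prop :=
  ∀ v : M, index K L (Module.Dual K M) =
    index K (stabilizer K L v) (Module.Dual K (M ⧸ tangentSubmodule K L v))

end Index

section Grading

variable {K L : Type*} [Field K] [LieRing L] [LieAlgebra K L]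

/-- `𝔤₀`, the fixed points of the automorphism `θ` of `𝔤`. -/
def gradeZero (θ : L ≃ₗ⁅K⁆ L) : LieSubalgebra K L where
  carrier := {x | θ x = x}
  add_mem' := by
    intro x y hx hy
    simp only [Set.mem_ofPred_eq] at hx hy ⊢
    rw [map_add, hx, hy]
  zero_mem' := map_zero θ
  smul_mem' := by
    intro c x hx
    simp only [Set.mem_ofPred_eq] at hx ⊢
    rw [map_smul, hx]
  lie_mem' := by
    intro x y hx hy
    change θ x = x at hx
    change θ y = y at hy
    change θ ⁅x, y⁆ = ⁅x, y⁆
    rw [LieEquiv.map_lie, hx, hy]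

/-- `𝔤₁`, the eigenspace of `θ` with eigenvalue `ζ`, as a `𝔤₀`-module under the adjoint action. -/
def gradeOne (θ : L ≃ₗ⁅K⁆ L) (ζ : K) : LieSubmodule K (gradeZero θ) L where
  carrier := {x | θ x = ζ • x}
  add_mem' := by
    intro x y hx hy
    simp only [Set.mem_ofPred_eq] at hx hy ⊢
    rw [map_add, hx, hy, smul_add]
  zero_mem' := by simp
  smul_mem' := by
    intro c x hx
    simp only [Set.mem_ofPred_eq] at hx ⊢
    rw [map_smul, hx, smul_comm]
  lie_mem := by
    rintro ⟨x, hx⟩ y hy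
    change θ x = x at hx
    change θ y = ζ • y at hy
    change θ ⁅x, y⁆ = ζ • ⁅x, y⁆
    rw [LieEquiv.map_lie, hx, hy, lie_smul]

end Grading

end ThetaRep

attribute [local instance 100] LieRing.ofAssociativeRing

namespace ThetaRep

section TypeA

variable {K V : Type*} [Field K] [AddCommGroup V] [Module K V]

/-- `θ` is an inner automorphism of `𝔤𝔩(V)`: conjugation by an element of `GL(V)`. -/
def IsInner (θ : Module.End K V ≃ₗ⁅K⁆ Module.End K V) : Prop :=
  ∃ g : V ≃ₗ[K] V, θ = g.lieConj

/-- A subspace of `𝔤₁` all of whose elements are semisimple and commute with one another. -/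
def IsToral (θ : Module.End K V ≃ₗ⁅K⁆ Module.End K V) (ζ : K)
    (c : Submodule K (Module.End K V)) : Prop :=
  (∀ x ∈ c, x ∈ gradeOne θ ζ) ∧ (∀ x ∈ c, x.IsSemisimple) ∧ ∀ x ∈ c, ∀ y ∈ c, ⁅x, y⁆ = 0

/-- A Cartan subspace of `𝔤₁`: a maximal subspace consisting of commuting semisimple elements. -/
def IsCartanSubspace (θ : Module.End K V ≃ₗ⁅K⁆ Module.End K V) (ζ : K)
    (c : Submodule K (Module.End K V)) : Prop :=
  Maximal (IsToral θ ζ) c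

/-- The rank of `(G₀, 𝔤₁)`: the common dimension of the Cartan subspaces of `𝔤₁`
(written as the supremum of their dimensions). -/
noncomputable def rank (θ : Module.End K V ≃ₗ⁅K⁆ Module.End K V) (ζ : K) : ℕ :=
  sSup {d | ∃ c : Submodule K (Module.End K V),
    IsCartanSubspace θ ζ c ∧ Module.finrank K c = d}

/-- `r = (r₀, …, r_{m-1})` is a multiplicities vector of `θ`: for some `g ∈ GL(V)` with `g ^ m = 1`
such that `θ` is the conjugation by `g`, `r_t` is the dimension of the
eigenspace of `g` with eigenvalue `ζ ^ t`. -/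
def IsMultiplicitiesVector (θ : Module.End K V ≃ₗ⁅K⁆ Module.End K V) (ζ : K) (m : ℕ)
    (r : ZMod m → ℕ) : Prop :=
  ∃ g : V ≃ₗ[K] V, θ = g.lieConj ∧ g ^ m = 1 ∧
    ∀ t : ZMod m, r t =
      Module.finrank K (Module.End.eigenspace (g : Module.End K V) (ζ ^ t.val))

end TypeA

end ThetaRep

/-!
Write `𝔤₀ = gradeZero θ`, `𝔤₁ = gradeOne θ ζ`, and `θ = g.lieConj` with `g ^ m = 1`, so that an
element of `𝔤₁` maps the `a`-eigenspace of `g` into the `ζ a`-eigenspace and `𝔤₁` is the space of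
representations of a cyclic quiver with `m` vertices.  The hypotheses are used only through their
consequence that all eigenspaces `V_t` of `g`, `t ∈ ℤ/m`, are nonzero and that three consecutive
ones, which may be taken to be `V_0`, `V_1`, `V_2`, have dimension at least two
(`one_le_finrank_eigenspace`, `two_le_finrank_eigenspace`).  Good index behaviour is then violated
at one explicit nilpotent element `x`, with two Jordan blocks of lengths `3` and `m - 1` and all
other blocks of length one; see `Frame` and `Frame.x`.

For a Lie algebra `L`, a module `M` and `x ∈ M`, good index behaviour at `0` and at `x` says that
`max_z dim L · z = max_w dim (L · x + L_x · w)`.  Hence it forces stabilisers to lift to second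
order: for generic `w`, if `y₀ ∈ L_x` and `⁅y₀, w⁆ + ⁅y₁, x⁆ = 0`, then
`⁅y₁, w⁆ ∈ L · x + L_x · w`.  Otherwise `⁅y₁, w⁆` would be a limit direction of
`L · (x + s w)` as `s → 0`, independent of the space `L · x + L_x · w` of limit directions, and
some orbit `L · (x + s w)` would be too big (`GIB.finite_setOf_not_liftable`).

For the element `x` above there are two linear forms `α`, `β` on `End V` which vanish on
`⁅𝔤₀, x⁆` and on which the stabiliser of `x` acts by opposite weights
(`Frame.exists_α_lie_β_lie`).  The differential `α(w) β + β(w) α` of their product at `w`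
therefore vanishes on `⁅𝔤₀, x⁆ + ⁅(𝔤₀)_x, w⁆`.  On the other hand, with explicit `y₀` and `y₁` as
above, its value at `⁅y₁, w⁆` is `α(w) ψ(w, w)` for a bilinear form `ψ`
(`Frame.obstruction_eq`), and this polynomial in `w` is not identically zero
(`Frame.α_w₁_ψ_w₁`).
-/

namespace ThetaRep

open Module

/-! ### Good index behaviour and lifting of stabilisers -/

/-- Lower semicontinuity of the rank in a pencil `A + s B` of linear maps: the rank is at least that
of `A` for all but finitely many `s`. -/
theorem finite_setOf_finrank_range_lt {K E M : Type*} [Field K] [AddCommGroup E] [Module K E]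
    [AddCommGroup M] [Module K M] [FiniteDimensional K M] (A B : E →ₗ[K] M) :
    {s : K | finrank K (LinearMap.range (A + s • B)) < finrank K (LinearMap.range A)}.Finite := by
  obtain ⟨i, hi⟩ := A.rangeRestrict.exists_rightInverse_of_surjective A.range_rangeRestrict
  obtain ⟨p, hp⟩ := (LinearMap.range A).subtype.exists_leftInverse_of_injective
    (Submodule.ker_subtype _)
  -- Compressed to the range of `A`, the pencil becomes `1 + s N`, which is singular only if `-s⁻¹`
  -- is an eigenvalue of `N`.
  set N : End K (LinearMap.range A) := p ∘ₗ B ∘ₗ i with hN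
  have key : ∀ s : K, p ∘ₗ (A + s • B) ∘ₗ i = 1 + s • N := by
    intro s
    ext1 v
    have h1 : A (i v) = v := congrArg Subtype.val (LinearMap.congr_fun hi v)
    have h2 : p v = v := LinearMap.congr_fun hp v
    simp [hN, h1, h2]
  have hfin : {s : K | N.HasEigenvalue (-s⁻¹)}.Finite := by
    refine (Module.End.finite_hasEigenvalue (f := N)).preimage (f := fun s : K => -s⁻¹) ?_
    intro a _ b _ hab
    simpa using hab
  refine hfin.subset fun s hs => ?_
  by_contra hne
  rw [Set.mem_ofPred_eq] at hs
  refine absurd hs (not_lt.2 ?_)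
  have hinj : Function.Injective ⇑(1 + s • N) := by
    rw [← LinearMap.ker_eq_bot, LinearMap.ker_eq_bot']
    intro v hv
    by_contra hv0
    apply hne
    have hs0 : s ≠ 0 := by
      rintro rfl
      simp at hv
      exact hv0 hv
    refine End.hasEigenvalue_of_hasEigenvector (x := v) ⟨End.mem_eigenspace_iff.2 ?_, hv0⟩
    have hv' : v + s • N v = 0 := by simpa using hv
    have : s • N v = -v := (neg_eq_of_add_eq_zero_right hv').symm
    rw [neg_smul, ← smul_neg, ← this, smul_smul, inv_mul_cancel₀ hs0, one_smul]
  rw [← key s] at hinj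
  have hinj' : Function.Injective ((A + s • B) ∘ₗ i) := by
    rw [LinearMap.coe_comp] at hinj
    exact hinj.of_comp
  calc finrank K (LinearMap.range A) = finrank K (LinearMap.range ((A + s • B) ∘ₗ i)) :=
        (LinearMap.finrank_range_of_inj hinj').symm
    _ ≤ _ := Submodule.finrank_mono (LinearMap.range_comp_le_range _ _)

section Index

variable {K L M : Type*} [Field K] [LieRing L] [LieAlgebra K L]
  [AddCommGroup M] [Module K M] [LieRingModule L M] [LieModule K L M]

variable (K L) in
/-- The infinitesimal orbit map `y ↦ ⁅y, v⁆` of `v`; its range is `L · v`, its kernel is `L_v`. -/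
def orbitMap (v : M) : L →ₗ[K] M := (LieModule.toEnd K L M : L →ₗ[K] End K M).flip v

@[simp] theorem orbitMap_apply (v : M) (x : L) : orbitMap K L v x = ⁅x, v⁆ := rfl

variable (K L) in
/-- The subspace `L · x + L_x · w` of `M`. Its image in the slice module `M / L · x` is the tangent
space of the `L_x`-orbit of the class of `w`. -/
def sliceTangent (x w : M) : Submodule K M :=
  tangent K L M x ⊔ (LinearMap.ker (orbitMap K L x)).map (orbitMap K L w)

variable [FiniteDimensional K M]

/-- As `M` is its own bidual, the index of `M*` is the least codimension of a tangent space `L · v`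
with `v ∈ M`. -/
theorem index_dual : index K L (Dual K M) =
    finrank K M - ⨆ v : M, finrank K (tangent K L M v) := by
  rw [index, Subspace.dual_finrank_eq]
  congr 1
  refine (Equiv.iSup_congr (evalEquiv K M).toEquiv fun v => ?_).symm
  have : tangent K L (Dual K (Dual K M)) (evalEquiv K M v) =
      (tangent K L M v).map (evalEquiv K M : M →ₗ[K] Dual K (Dual K M)) := by
    have hx : ∀ x : L, ⁅x, evalEquiv K M v⁆ = evalEquiv K M ⁅x, v⁆ := by
      intro x
      ext f
      simp
    ext ξ
    constructor
    · rintro ⟨x, rfl⟩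
      exact ⟨⁅x, v⁆, ⟨x, rfl⟩, (hx x).symm⟩
    · rintro ⟨_, ⟨x, rfl⟩, rfl⟩
      exact ⟨x, hx x⟩
  change finrank K (tangent K L (Dual K (Dual K M)) (evalEquiv K M v)) = _
  rw [this, LinearEquiv.finrank_map_eq]

theorem bddAbove_finrank_tangent :
    BddAbove (Set.range fun v : M => finrank K (tangent K L M v)) :=
  ⟨finrank K M, by rintro _ ⟨v, rfl⟩; exact Submodule.finrank_le _⟩

variable (K L M) in
theorem exists_finrank_tangent_eq_iSup :
    ∃ v : M, finrank K (tangent K L M v) = ⨆ v : M, finrank K (tangent K L M v) :=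
  Nat.sSup_mem (Set.range_nonempty _) bddAbove_finrank_tangent

/-- Good index behaviour at `x`, written without indices: for some `w` the space `L · x + L_x · w`
is at least as big as every `L · z`. -/
theorem GIB.exists_finrank_tangent_le (h : GIB K L M) (x : M) :
    ∃ w : M, ∀ z : M, finrank K (tangent K L M z) ≤ finrank K (sliceTangent K L x w) := by
  obtain ⟨wb, hw⟩ := exists_finrank_tangent_eq_iSup K (stabilizer K L x)
    (M ⧸ tangentSubmodule K L x)
  obtain ⟨z0, hz0⟩ := exists_finrank_tangent_eq_iSup K L M
  obtain ⟨w, rfl⟩ := Submodule.mkQ_surjective (tangentSubmodule K L x).toSubmodule wb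
  refine ⟨w, fun z => (le_ciSup bddAbove_finrank_tangent z).trans ?_⟩
  have hx := h x
  rw [index_dual, index_dual, ← hw, ← hz0] at hx
  have h0 : finrank K (tangent K L M z0) ≤ finrank K M := Submodule.finrank_le _
  have h1 := Submodule.finrank_le (tangent K (stabilizer K L x) (M ⧸ tangentSubmodule K L x)
    ((tangentSubmodule K L x).toSubmodule.mkQ w))
  have h2 : finrank K (M ⧸ tangentSubmodule K L x) + finrank K (tangent K L M x) = finrank K M :=
    Submodule.finrank_quotient_add_finrank (tangent K L M x)
  rw [← hz0]
  set T := tangent K L M x with hT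
  have h3 : tangent K (stabilizer K L x) (M ⧸ tangentSubmodule K L x)
      ((tangentSubmodule K L x).toSubmodule.mkQ w) = (sliceTangent K L x w).map T.mkQ := by
    rw [sliceTangent, Submodule.map_sup, Submodule.mkQ_map_self, bot_sup_eq]
    ext ξ
    constructor
    · rintro ⟨⟨y, hy⟩, rfl⟩
      exact ⟨⁅y, w⁆, ⟨y, hy, rfl⟩, rfl⟩
    · rintro ⟨_, ⟨y, hy, rfl⟩, rfl⟩
      exact ⟨⟨y, hy⟩, rfl⟩
  have h4 : finrank K ((sliceTangent K L x w).map T.mkQ) + finrank K T =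
      finrank K (sliceTangent K L x w) := by
    have := LinearMap.finrank_range_add_finrank_ker (T.mkQ ∘ₗ (sliceTangent K L x w).subtype)
    rw [LinearMap.range_comp, Submodule.range_subtype, LinearMap.ker_comp,
      Submodule.ker_mkQ] at this
    have hle : T ≤ sliceTangent K L x w := le_sup_left
    rw [← this, (Submodule.comapSubtypeEquivOfLe hle).finrank_eq]
  have h5 : finrank K (tangent K (stabilizer K L x) (M ⧸ tangentSubmodule K L x)
      ((tangentSubmodule K L x).toSubmodule.mkQ w)) + finrank K T =
      finrank K (sliceTangent K L x w) := by
    rw [h3]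
    exact h4
  omega

/-- Under good index behaviour, second-order lifting along `x + s w` is unobstructed for generic
`w`: on any line through a suitable `w₀`, all but finitely many points `w` have the property that
`⁅y₀, x⁆ = 0` and `⁅y₀, w⁆ + ⁅y₁, x⁆ = 0` imply `⁅y₁, w⁆ ∈ L · x + L_x · w`. -/
theorem GIB.finite_setOf_not_liftable (h : GIB K L M) [Infinite K] (x : M) :
    ∃ w₀ : M, ∀ w₁ : M, {c : K | ¬ ∀ y₀ y₁ : L, ⁅y₀, x⁆ = 0 → ⁅y₀, w₀ + c • w₁⁆ + ⁅y₁, x⁆ = 0 →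
      ⁅y₁, w₀ + c • w₁⁆ ∈ sliceTangent K L x (w₀ + c • w₁)}.Finite := by
  obtain ⟨w₀, hw₀⟩ := h.exists_finrank_tangent_le x
  refine ⟨w₀, fun w₁ => ?_⟩
  -- The range of `Φ w` is `L · x + L_x · w`, so the dimension of the latter can only drop at
  -- finitely many points of a line.
  let κ := LinearMap.ker (orbitMap K L x)
  let Φ (w : M) : L × κ →ₗ[K] M :=
    (orbitMap K L x).coprod (orbitMap K L w ∘ₗ κ.subtype)
  have hΦ : ∀ w, LinearMap.range (Φ w) = sliceTangent K L x w := by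
    intro w
    rw [LinearMap.range_coprod, LinearMap.range_comp, Submodule.range_subtype]
    rfl
  let Ψ : L × κ →ₗ[K] M := (0 : L →ₗ[K] M).coprod (orbitMap K L w₁ ∘ₗ κ.subtype)
  refine (finite_setOf_finrank_range_lt (Φ w₀) Ψ).subset fun c hc => ?_
  by_contra hlt
  apply hc
  intro y₀ y₁ h0 h1
  have hc' : Φ w₀ + c • Ψ = Φ (w₀ + c • w₁) := by
    refine LinearMap.ext fun v => ?_
    simp [Φ, Ψ, add_assoc]
  rw [Set.mem_ofPred_eq, not_lt, hc', hΦ, hΦ] at hlt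
  set w := w₀ + c • w₁
  by_contra hmem
  -- The pencil `A + s B` has range `L · x + L_x · w + K ⁅y₁, w⁆` at `s = 0`, and range inside
  -- `L · (x + s w)` for `s ≠ 0`.
  let A : (L × κ) × K →ₗ[K] M := (Φ w).coprod (LinearMap.toSpanSingleton K M ⁅y₁, w⁆)
  let B : (L × κ) × K →ₗ[K] M := (orbitMap K L w ∘ₗ LinearMap.fst K L κ).coprod 0
  have hA : finrank K (sliceTangent K L x w) < finrank K (LinearMap.range A) := by
    apply Submodule.finrank_lt_finrank_of_lt
    refine lt_of_le_of_ne ?_ ?_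
    · rw [← hΦ]
      rintro _ ⟨v, rfl⟩
      exact ⟨(v, 0), by simp [A]⟩
    · intro heq
      apply hmem
      rw [heq]
      exact ⟨(0, 1), by simp [A]⟩
  obtain ⟨s, hs⟩ :=
    ((finite_setOf_finrank_range_lt A B).union (Set.finite_singleton 0)).exists_notMem
  simp only [Set.mem_union, Set.mem_ofPred_eq, Set.mem_singleton_iff, not_or, not_lt] at hs
  obtain ⟨hs1, hs0⟩ := hs
  have hle : LinearMap.range (A + s • B) ≤ tangent K L M (x + s • w) := by
    rintro _ ⟨⟨⟨y, k, hk⟩, t⟩, rfl⟩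
    have hk' : ⁅k, x⁆ = 0 := hk
    -- Here `⁅y₀ + s y₁, x + s w⁆ = s² ⁅y₁, w⁆`.
    refine ⟨y + s⁻¹ • k + (t * (s⁻¹ * s⁻¹)) • (y₀ + s • y₁), ?_⟩
    have e1 : ⁅y₁, x⁆ = -⁅y₀, w⁆ := (neg_eq_of_add_eq_zero_right h1).symm
    simp only [add_lie, lie_add, smul_lie, lie_smul, hk', h0, e1, A, B, Φ, LinearMap.add_apply,
      LinearMap.smul_apply, LinearMap.coprod_apply, orbitMap_apply, LinearMap.comp_apply,
      LinearMap.toSpanSingleton_apply, LinearMap.fst_apply, Submodule.subtype_apply,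
      LinearMap.zero_apply]
    match_scalars <;> field_simp
    ring
  have := (Submodule.finrank_mono hle).trans (hw₀ _)
  omega

end Index

/-! ### The grading of `End K V` defined by an element of `GL(V)` -/

section Conj

variable {K V : Type*} [Field K] [AddCommGroup V] [Module K V] {g : V ≃ₗ[K] V} {ζ : K}

theorem mem_gradeZero_lieConj {y : End K V} :
    y ∈ gradeZero g.lieConj ↔ ∀ v, g (y v) = y (g v) := by
  change g.lieConj y = y ↔ _
  rw [LinearEquiv.lieConj_apply, LinearMap.ext_iff]
  constructor
  · intro h v
    simpa [LinearEquiv.conj_apply] using h (g v)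
  · intro h v
    simp [LinearEquiv.conj_apply, h]

theorem mem_gradeOne_lieConj {w : End K V} :
    w ∈ gradeOne g.lieConj ζ ↔ ∀ v, g (w v) = ζ • w (g v) := by
  change g.lieConj w = ζ • w ↔ _
  rw [LinearEquiv.lieConj_apply, LinearMap.ext_iff]
  constructor
  · intro h v
    simpa [LinearEquiv.conj_apply] using h (g v)
  · intro h v
    simp [LinearEquiv.conj_apply, h]

variable {m : ℕ} {χ : ZMod m → K}

theorem map_apply_of_mem_gradeOne {w : End K V} (hw : w ∈ gradeOne g.lieConj ζ)
    (hχ : ∀ t, χ (t + 1) = ζ * χ t) {t : ZMod m} {v : V} (hv : g v = χ t • v) :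
    g (w v) = χ (t + 1) • w v := by
  rw [mem_gradeOne_lieConj.1 hw, hv, map_smul, smul_smul, hχ]

theorem smulRight_mem_gradeOne (hχ : ∀ t, χ (t + 1) = ζ * χ t) {t : ZMod m}
    {f : Dual K V} {v : V} (hf : ∀ v, f (g v) = χ t * f v) (hv : g v = χ (t + 1) • v) :
    f.smulRight v ∈ gradeOne g.lieConj ζ := by
  rw [mem_gradeOne_lieConj]
  intro u
  simp only [LinearMap.smulRight_apply, map_smul, hv, hf, smul_smul, hχ]
  congr 1
  ring

/-- An eigenform of `g` vanishes on the eigenvectors of `g` with a different eigenvalue. -/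
theorem dual_apply_eq_zero {a b : K} {f : Dual K V} {v : V} (hab : a ≠ b)
    (hf : ∀ v, f (g v) = a * f v) (hv : g v = b • v) : f v = 0 := by
  have h := hf v
  rw [hv, map_smul, smul_eq_mul] at h
  have : (a - b) * f v = 0 := by rw [sub_mul, h, sub_self]
  exact (mul_eq_zero.1 this).resolve_left (sub_ne_zero.2 hab)

theorem natCast_zmod_ne_zero {m k : ℕ} (hk : 0 < k) (hkm : k < m) : (k : ZMod m) ≠ 0 := by
  rw [Ne, ZMod.natCast_eq_zero_iff]
  exact Nat.not_dvd_of_pos_of_lt hk hkm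

theorem zmod_one_two_three_ne_zero (hm : 4 ≤ m) :
    (1 : ZMod m) ≠ 0 ∧ (2 : ZMod m) ≠ 0 ∧ (3 : ZMod m) ≠ 0 := by
  refine ⟨?_, ?_, ?_⟩
  · exact_mod_cast natCast_zmod_ne_zero (m := m) (k := 1) (by omega) (by omega)
  · exact_mod_cast natCast_zmod_ne_zero (m := m) (k := 2) (by omega) (by omega)
  · exact_mod_cast natCast_zmod_ne_zero (m := m) (k := 3) (by omega) (by omega)

end Conj

/-! ### The nilpotent element attached to a frame -/

/-- Homogeneous vectors and linear forms for an automorphism `g` with eigenvalues `χ t`,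
`t ∈ ℤ/m`. In degree `t` there are a vector `e t` and a linear form `f t` with `f t (e t) = 1`, and
the vector `p t` is `e t`, except that in degrees `0` and `2` it is a vector `p t ≠ 0` killed by
`f t`. The vector `b` of degree `1` and the forms `h₀`, `h₁` of degrees `0` and `1` express that
the eigenspace of degree `1` also has dimension at least two; they only enter the test element
`Frame.w₁`. -/
structure Frame {K V : Type*} [Field K] [AddCommGroup V] [Module K V] {m : ℕ}
    (g : V ≃ₗ[K] V) (χ : ZMod m → K) where
  e : ZMod m → V
  p : ZMod m → V
  f : ZMod m → Dual K V
  b : V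
  h₀ : Dual K V
  h₁ : Dual K V
  map_e : ∀ t, g (e t) = χ t • e t
  map_p : ∀ t, g (p t) = χ t • p t
  f_map : ∀ t v, f t (g v) = χ t * f t v
  map_b : g b = χ 1 • b
  h₀_map : ∀ v, h₀ (g v) = χ 0 * h₀ v
  h₁_map : ∀ v, h₁ (g v) = χ 1 * h₁ v
  f_e : ∀ t, f t (e t) = 1
  p_eq : ∀ t, t ≠ 0 → t ≠ 2 → p t = e t
  p_ne : ∀ t, p t ≠ 0
  f_p_zero : f 0 (p 0) = 0
  f_p_two : f 2 (p 2) = 0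
  f_b : f 1 b = 0
  h₀_p : h₀ (p 0) = 1
  h₁_b : h₁ b = 1
  h₁_e : h₁ (e 1) = 0

namespace Frame

variable {K V : Type*} [Field K] [AddCommGroup V] [Module K V] {m : ℕ}
  {g : V ≃ₗ[K] V} {χ : ZMod m → K} {ζ : K} (F : Frame g χ)

theorem f_eq_zero (hinj : Function.Injective χ) {s t : ZMod m} (hst : s ≠ t) {v : V}
    (hv : g v = χ t • v) : F.f s v = 0 :=
  dual_apply_eq_zero (hinj.ne hst) (F.f_map s) hv

theorem f_p (t : ZMod m) (h0 : t ≠ 0) (h2 : t ≠ 2) : F.f t (F.p t) = 1 := by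
  rw [F.p_eq t h0 h2, F.f_e]

theorem linearIndependent_p (hinj : Function.Injective χ) :
    LinearIndependent K fun t => F.p (t + 1) :=
  Module.End.eigenvectors_linearIndependent' (g : End K V) (fun t => χ (t + 1))
    (fun _ _ h => add_right_cancel (hinj h)) _
    fun _ => ⟨Module.End.mem_eigenspace_iff.2 (F.map_p _), F.p_ne _⟩

/-- The eigenvalues `l t` are constant along the Jordan blocks of `x`: they can only change at the
degrees `0` and `2`, where `f t (p t) = 0`. -/
theorem scalars_eq {l : ZMod m → K} {y : End K V} (hl : ∀ t, y (F.p (t + 1)) = l t • F.p (t + 1))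
    (hl' : ∀ t v, F.f t (y v) = l t * F.f t v) (t : ZMod m) (h0 : t + 1 ≠ 0) (h2 : t + 1 ≠ 2) :
    l (t + 1) = l t := by
  have h := hl' (t + 1) (F.p (t + 1))
  rw [hl, map_smul, F.f_p _ h0 h2, smul_eq_mul, mul_one, mul_one] at h
  exact h.symm

theorem scalars_neg_one (hm : 4 ≤ m) {l : ZMod m → K} {y : End K V}
    (hl : ∀ t, y (F.p (t + 1)) = l t • F.p (t + 1))
    (hl' : ∀ t v, F.f t (y v) = l t * F.f t v) : l (-1) = l 2 := by
  have key : ∀ k : ℕ, k + 2 < m → l ((k + 2 : ℕ) : ZMod m) = l 2 := by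
    intro k
    induction k with
    | zero => intro _; simp
    | succ k ih =>
      intro hk
      rw [← ih (by omega)]
      have hc : ((k + 1 + 2 : ℕ) : ZMod m) = ((k + 2 : ℕ) : ZMod m) + 1 := by push_cast; ring
      rw [hc]
      apply F.scalars_eq hl hl'
      · rw [← hc, Ne, ZMod.natCast_eq_zero_iff]
        exact Nat.not_dvd_of_pos_of_lt (by omega) hk
      · rw [← hc]
        intro h
        have h' : ((k + 1 : ℕ) : ZMod m) = 0 := by
          push_cast at h ⊢
          linear_combination h
        rw [ZMod.natCast_eq_zero_iff] at h'
        exact Nat.not_dvd_of_pos_of_lt (by omega) (by omega) h'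
  have := key (m - 3) (by omega)
  rwa [show m - 3 + 2 = m - 1 by omega, Nat.cast_sub (by omega), ZMod.natCast_self, Nat.cast_one,
    zero_sub] at this

/-- A linear form vanishing on `⁅𝔤₀, x⁆`, with `α ⁅y, w⁆ = (l 2 - l 0) α w` for `y` in the
stabiliser of `x`, where `l` is as in `exists_scalars`. -/
def α : Dual K (End K V) :=
  F.f 2 ∘ₗ LinearMap.applyₗ (F.p 1) + F.f 3 ∘ₗ LinearMap.applyₗ (F.p 2)

/-- A linear form vanishing on `⁅𝔤₀, x⁆`, with `β ⁅y, w⁆ = (l 0 - l 2) β w` for `y` in the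
stabiliser of `x`, where `l` is as in `exists_scalars`. -/
def β : Dual K (End K V) :=
  F.f 1 ∘ₗ LinearMap.applyₗ (F.p 0) + F.f 0 ∘ₗ LinearMap.applyₗ (F.p (-1))

theorem α_apply (w : End K V) : F.α w = F.f 2 (w (F.p 1)) + F.f 3 (w (F.p 2)) := rfl

theorem β_apply (w : End K V) : F.β w = F.f 1 (w (F.p 0)) + F.f 0 (w (F.p (-1))) := rfl

section Nilpotent

variable [NeZero m]

/-- The element `x = ∑ p (t + 1) ⊗ f t`, of rank one on each eigenspace of `g`. Its Jordan blocks of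
length more than one are `e 0 ↦ e 1 ↦ p 2 ↦ 0` and `e 2 ↦ e 3 ↦ ⋯ ↦ e (-1) ↦ p 0 ↦ 0`. -/
def x : End K V := ∑ t, (F.f t).smulRight (F.p (t + 1))

theorem x_apply (v : V) : F.x v = ∑ t, F.f t v • F.p (t + 1) := by
  simp [x, LinearMap.sum_apply]

theorem x_mem (hχ : ∀ t, χ (t + 1) = ζ * χ t) : F.x ∈ gradeOne g.lieConj ζ := by
  rw [mem_gradeOne_lieConj]
  intro v
  simp only [x_apply, map_sum, map_smul, F.map_p, F.f_map, Finset.smul_sum, smul_smul, hχ]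
  refine Finset.sum_congr rfl fun t _ => ?_
  congr 1
  ring

theorem x_of_mem (hinj : Function.Injective χ) {t : ZMod m} {v : V} (hv : g v = χ t • v) :
    F.x v = F.f t v • F.p (t + 1) := by
  rw [x_apply, Finset.sum_eq_single t]
  · intro s _ hs
    rw [F.f_eq_zero hinj hs hv, zero_smul]
  · simp

theorem f_x (hinj : Function.Injective χ) (t : ZMod m) (v : V) :
    F.f (t + 1) (F.x v) = F.f t v * F.f (t + 1) (F.p (t + 1)) := by
  rw [x_apply, map_sum, Finset.sum_eq_single t]
  · simp
  · intro s _ hs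
    rw [map_smul, F.f_eq_zero hinj (fun h => hs (add_right_cancel h).symm) (F.map_p _), smul_zero]
  · simp

theorem x_p_zero (hinj : Function.Injective χ) : F.x (F.p 0) = 0 := by
  rw [F.x_of_mem hinj (F.map_p 0), F.f_p_zero, zero_smul]

theorem x_p_two (hinj : Function.Injective χ) : F.x (F.p 2) = 0 := by
  rw [F.x_of_mem hinj (F.map_p 2), F.f_p_two, zero_smul]

theorem x_p (hinj : Function.Injective χ) (t : ZMod m) (h0 : t ≠ 0) (h2 : t ≠ 2) :
    F.x (F.p t) = F.p (t + 1) := by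
  rw [F.x_of_mem hinj (F.map_p t), F.f_p t h0 h2, one_smul]

theorem x_e (hinj : Function.Injective χ) (t : ZMod m) : F.x (F.e t) = F.p (t + 1) := by
  rw [F.x_of_mem hinj (F.map_e t), F.f_e, one_smul]

theorem f_zero_x (hinj : Function.Injective χ) (v : V) : F.f 0 (F.x v) = 0 := by
  have := F.f_x hinj (-1) v
  rwa [neg_add_cancel, F.f_p_zero, mul_zero] at this

theorem f_two_x (hinj : Function.Injective χ) (v : V) : F.f 2 (F.x v) = 0 := by
  have := F.f_x hinj 1 v
  rwa [one_add_one_eq_two, F.f_p_two, mul_zero] at this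

theorem f_one_x (hm : 4 ≤ m) (hinj : Function.Injective χ) (v : V) :
    F.f 1 (F.x v) = F.f 0 v := by
  obtain ⟨h1, h2, h3⟩ := zmod_one_two_three_ne_zero hm
  have := F.f_x hinj 0 v
  rwa [zero_add, F.f_p 1 h1 (fun h => h1 (by linear_combination -h)), mul_one] at this

theorem f_three_x (hm : 4 ≤ m) (hinj : Function.Injective χ) (v : V) :
    F.f 3 (F.x v) = F.f 2 v := by
  obtain ⟨h1, h2, h3⟩ := zmod_one_two_three_ne_zero hm
  have := F.f_x hinj 2 v
  rwa [two_add_one_eq_three, F.f_p 3 h3 (fun h => h1 (by linear_combination h)), mul_one] at this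

/-! ### The action of the stabiliser of the nilpotent element on `α` and `β` -/

/-- If an element `y` of degree zero commutes with `x`, then each `p (t + 1)` is an eigenvector of
`y` and each `f t` is an eigenform of `y`, with the same eigenvalue `l t`. -/
theorem exists_scalars (hinj : Function.Injective χ) {y : End K V} (hy : ∀ v, g (y v) = y (g v))
    (hyx : ∀ v, y (F.x v) = F.x (y v)) :
    ∃ l : ZMod m → K, (∀ t, y (F.p (t + 1)) = l t • F.p (t + 1)) ∧
      ∀ t v, F.f t (y v) = l t * F.f t v := by
  have h1 : ∀ t, y (F.p (t + 1)) = F.f t (y (F.e t)) • F.p (t + 1) := by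
    intro t
    have hx : F.x (F.e t) = F.p (t + 1) := by
      rw [F.x_of_mem hinj (F.map_e t), F.f_e, one_smul]
    rw [← hx, hyx, F.x_of_mem (t := t) hinj, hx]
    rw [hy, F.map_e, map_smul]
  -- Comparing coefficients of the independent vectors `p (t + 1)` in `y (x v) = x (y v)`.
  refine ⟨fun t => F.f t (y (F.e t)), h1, fun t v => ?_⟩
  have h2 := hyx v
  rw [x_apply, x_apply, map_sum] at h2
  simp only [map_smul, h1, smul_smul] at h2
  have h3 := Fintype.linearIndependent_iff.1 (F.linearIndependent_p hinj)
    (fun t => F.f t v * F.f t (y (F.e t)) - F.f t (y v))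
    (by simp only [sub_smul, Finset.sum_sub_distrib, h2, sub_self]) t
  rw [mul_comm, eq_comm]
  exact sub_eq_zero.1 h3

theorem α_lie_x (hm : 4 ≤ m) (hinj : Function.Injective χ) (y : End K V) :
    F.α ⁅y, F.x⁆ = 0 := by
  obtain ⟨h1, h2, h3⟩ := zmod_one_two_three_ne_zero hm
  have hx := F.x_p hinj 1 h1 (fun h => h1 (by linear_combination -h))
  rw [one_add_one_eq_two] at hx
  simp [α_apply, LieRing.of_associative_ring_bracket, hx, F.f_two_x hinj, F.x_p_two hinj,
    F.f_three_x hm hinj]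

theorem β_lie_x (hm : 4 ≤ m) (hinj : Function.Injective χ) (y : End K V) :
    F.β ⁅y, F.x⁆ = 0 := by
  obtain ⟨h1, h2, h3⟩ := zmod_one_two_three_ne_zero hm
  have hx := F.x_p hinj (-1) (fun h => h1 (by linear_combination -h))
    (fun h => h3 (by linear_combination -h))
  rw [neg_add_cancel] at hx
  simp [β_apply, LieRing.of_associative_ring_bracket, hx, F.f_zero_x hinj, F.x_p_zero hinj,
    F.f_one_x hm hinj]

/-- The stabiliser of `x` acts on `α` and `β` by opposite characters: the difference of the
eigenvalues of its elements on the two long Jordan blocks, and its negative. This needs `4 ≤ m`: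
for `m = 3` the form `f 3 = f 0` would belong to the other block. -/
theorem exists_α_lie_β_lie (hm : 4 ≤ m) (hinj : Function.Injective χ) {y : End K V}
    (hy : ∀ v, g (y v) = y (g v)) (hyx : ∀ v, y (F.x v) = F.x (y v)) :
    ∃ c : K, ∀ w : End K V, F.α ⁅y, w⁆ = c * F.α w ∧ F.β ⁅y, w⁆ = -c * F.β w := by
  obtain ⟨h1, h2, h3⟩ := zmod_one_two_three_ne_zero hm
  obtain ⟨l, hl, hl'⟩ := F.exists_scalars hinj hy hyx
  have l1 : l 1 = l 0 := by
    have := F.scalars_eq hl hl' 0 (by rwa [zero_add])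
      (fun h => h1 (by linear_combination -h))
    rwa [zero_add] at this
  have l3 : l 3 = l 2 := by
    have := F.scalars_eq hl hl' 2 (fun h => h3 (by linear_combination h))
      (fun h => h1 (by linear_combination h))
    rwa [two_add_one_eq_three] at this
  have l4 := F.scalars_neg_one hm hl hl'
  have l5 : l (-1) = l (-2) := by
    have := F.scalars_eq hl hl' (-2) (fun h => h1 (by linear_combination -h))
      (fun h => h3 (by linear_combination -h))
    rwa [show (-2 + 1 : ZMod m) = -1 by ring] at this
  have p0 := hl (-1)
  have p1 := hl 0
  have p2 := hl 1
  have p3 := hl (-2)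
  rw [neg_add_cancel] at p0
  rw [zero_add] at p1
  rw [one_add_one_eq_two] at p2
  rw [show (-2 + 1 : ZMod m) = -1 by ring] at p3
  refine ⟨l 2 - l 0, fun w => ⟨?_, ?_⟩⟩
  · simp only [α_apply, LieRing.of_associative_ring_bracket,
      Module.End.mul_apply, map_sub, p1, p2, map_smul, hl', smul_eq_mul, l1, l3]
    ring
  · simp only [β_apply, LieRing.of_associative_ring_bracket,
      Module.End.mul_apply, map_sub, p0, p3, map_smul, hl', smul_eq_mul, l1, ← l5, l4]
    ring

end Nilpotent

/-! ### The second-order obstruction -/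

/-- The bilinear form such that `α(w) ψ(w, w)` is the second-order obstruction. The coefficient
`f 3 (p (-1))` is `1` for `m = 4` and `0` for larger `m`. -/
def ψ : LinearMap.BilinMap K (End K V) K := LinearMap.mk₂ K
  (fun w w' => F.f 2 (w (w' (F.p 0))) - F.f 2 (w (F.p 1)) * F.f 1 (w' (F.p 0)) -
    F.f 3 (F.p (-1)) *
      (F.f 0 (w (w' (F.p 2))) - F.f 0 (w (F.e 3)) * F.f 3 (w' (F.p 2))))
  (by intros; simp; ring) (by intros; simp; ring) (by intros; simp; ring) (by intros; simp; ring)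

theorem ψ_apply (w w' : End K V) : F.ψ w w' = F.f 2 (w (w' (F.p 0))) -
    F.f 2 (w (F.p 1)) * F.f 1 (w' (F.p 0)) - F.f 3 (F.p (-1)) *
      (F.f 0 (w (w' (F.p 2))) - F.f 0 (w (F.e 3)) * F.f 3 (w' (F.p 2))) := rfl

/-- An element of `𝔤₀` commuting with `x`: it maps the generator `e 2` of the block of length
`m - 1` to the end `p 2` of the block of length `3`. -/
def y₀ : End K V := (F.f 2).smulRight (F.p 2)

theorem y₀_mem : F.y₀ ∈ gradeZero g.lieConj := by
  rw [mem_gradeZero_lieConj]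
  intro v
  simp [y₀, F.map_p, F.f_map, smul_smul, mul_comm]

/-- A solution in `𝔤₀` of the first-order lifting equation `⁅y₀, w⁆ + ⁅y₁, x⁆ = 0`. -/
def y₁ (w : End K V) : End K V :=
  (F.f 3).smulRight (w (F.p 2)) + (F.f 2 ∘ₗ w).smulRight (F.p 1) +
    F.f 2 (w (F.p 1)) • (F.f 0).smulRight (F.e 0) -
    F.f 3 (w (F.p 2)) • ((F.f 2).smulRight (F.e 2) + (F.f 3).smulRight (F.e 3))

theorem y₁_apply (w : End K V) (v : V) : F.y₁ w v = F.f 3 v • w (F.p 2) + F.f 2 (w v) • F.p 1 +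
    F.f 2 (w (F.p 1)) • F.f 0 v • F.e 0 -
      F.f 3 (w (F.p 2)) • (F.f 2 v • F.e 2 + F.f 3 v • F.e 3) := rfl

theorem y₁_mem (hχ : ∀ t, χ (t + 1) = ζ * χ t) {w : End K V} (hw : w ∈ gradeOne g.lieConj ζ) :
    F.y₁ w ∈ gradeZero g.lieConj := by
  have hw' := mem_gradeOne_lieConj.1 hw
  have h3 := map_apply_of_mem_gradeOne hw hχ (F.map_p 2)
  rw [two_add_one_eq_three] at h3
  have h2 : ∀ v, F.f 2 (w (g v)) = χ 1 * F.f 2 (w v) := by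
    intro v
    have hζ : ζ ≠ 0 := by
      rintro rfl
      have h0 : χ 2 = 0 := by simpa [one_add_one_eq_two] using hχ 1
      have := F.map_p 2
      rw [h0, zero_smul, LinearEquiv.map_eq_zero_iff] at this
      exact F.p_ne 2 this
    have e1 : F.f 2 (g (w v)) = ζ * F.f 2 (w (g v)) := by rw [hw', map_smul, smul_eq_mul]
    rw [F.f_map, ← one_add_one_eq_two, hχ, mul_assoc] at e1
    rw [← one_add_one_eq_two]
    exact (mul_left_cancel₀ hζ e1).symm
  rw [mem_gradeZero_lieConj]
  intro v
  simp only [y₁_apply, map_add, map_sub, map_smul, h3, F.map_p, F.map_e, F.f_map, h2]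
  module

/-- A test element at which the obstruction `α(w) ψ(w, w)` does not vanish; it maps
`p 0 ↦ b ↦ e 2` and `p 1 = e 1 ↦ e 2`. -/
def w₁ : End K V :=
  F.h₀.smulRight F.b + F.h₁.smulRight (F.e 2) + (F.f 1).smulRight (F.e 2)

theorem w₁_mem (hχ : ∀ t, χ (t + 1) = ζ * χ t) : F.w₁ ∈ gradeOne g.lieConj ζ := by
  refine add_mem (add_mem ?_ ?_) ?_
  · exact smulRight_mem_gradeOne hχ (t := 0) F.h₀_map (by rw [zero_add]; exact F.map_b)
  · exact smulRight_mem_gradeOne hχ (t := 1) F.h₁_map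
      (by rw [one_add_one_eq_two]; exact F.map_e 2)
  · exact smulRight_mem_gradeOne hχ (t := 1) (F.f_map 1)
      (by rw [one_add_one_eq_two]; exact F.map_e 2)

theorem α_w₁_ψ_w₁ (hm : 4 ≤ m) (hinj : Function.Injective χ) :
    F.α F.w₁ = 1 ∧ F.ψ F.w₁ F.w₁ = 1 := by
  obtain ⟨h1, h2, h3⟩ := zmod_one_two_three_ne_zero hm
  have n12 : (1 : ZMod m) ≠ 2 := fun h => h1 (by linear_combination -h)
  have n13 : (1 : ZMod m) ≠ 3 := fun h => h2 (by linear_combination -h)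
  have hp1 := F.p_eq 1 h1 n12
  have h0 : ∀ {t : ZMod m} {v : V}, 0 ≠ t → g v = χ t • v → F.h₀ v = 0 := fun ht hv =>
    dual_apply_eq_zero (hinj.ne ht) F.h₀_map hv
  have h1' : ∀ {t : ZMod m} {v : V}, 1 ≠ t → g v = χ t • v → F.h₁ v = 0 := fun ht hv =>
    dual_apply_eq_zero (hinj.ne ht) F.h₁_map hv
  have f1 : ∀ {t : ZMod m} {v : V}, 1 ≠ t → g v = χ t • v → F.f 1 v = 0 := fun ht hv =>
    F.f_eq_zero hinj ht hv
  have e1 : F.w₁ (F.p 1) = F.e 2 := by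
    simp [w₁, hp1, F.h₁_e, F.f_e, h0 h1.symm (F.map_e 1)]
  have e2 : F.w₁ (F.p 2) = 0 := by
    simp [w₁, h0 h2.symm (F.map_p 2), h1' n12 (F.map_p 2), f1 n12 (F.map_p 2)]
  have e0 : F.w₁ (F.p 0) = F.b := by
    simp [w₁, F.h₀_p, h1' h1 (F.map_p 0), f1 h1 (F.map_p 0)]
  have eb : F.w₁ F.b = F.e 2 := by
    simp [w₁, h0 h1.symm F.map_b, F.h₁_b, F.f_b]
  constructor
  · simp [α_apply, e1, e2, F.f_e]
  · simp [ψ_apply, e0, e1, e2, eb, F.f_e, F.f_b]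

/-- The differential of `α β` at `w`, evaluated at the obstruction class `⁅y₁, w⁆`. -/
theorem obstruction_eq (hm : 4 ≤ m) (hχ : ∀ t, χ (t + 1) = ζ * χ t)
    (hinj : Function.Injective χ) {w : End K V} (hw : w ∈ gradeOne g.lieConj ζ) :
    F.α w * F.β ⁅F.y₁ w, w⁆ + F.β w * F.α ⁅F.y₁ w, w⁆ = F.α w * F.ψ w w := by
  obtain ⟨h1, h2, h3⟩ := zmod_one_two_three_ne_zero hm
  have n01 : (0 : ZMod m) ≠ 1 := h1.symm
  have n02 : (0 : ZMod m) ≠ 2 := h2.symm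
  have n03 : (0 : ZMod m) ≠ 3 := h3.symm
  have n12 : (1 : ZMod m) ≠ 2 := fun h => h1 (by linear_combination -h)
  have n13 : (1 : ZMod m) ≠ 3 := fun h => h2 (by linear_combination -h)
  have n23 : (2 : ZMod m) ≠ 3 := fun h => h1 (by linear_combination -h)
  have n0' : (0 : ZMod m) ≠ -1 := fun h => h1 (by linear_combination h)
  have n2' : (2 : ZMod m) ≠ -1 := fun h => h3 (by linear_combination h)
  have w2 : g (w (F.p 2)) = χ 3 • w (F.p 2) := by
    have := map_apply_of_mem_gradeOne hw hχ (F.map_p 2)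
    rwa [two_add_one_eq_three] at this
  have w0 : g (w (F.p 0)) = χ 1 • w (F.p 0) := by
    have := map_apply_of_mem_gradeOne hw hχ (F.map_p 0)
    rwa [zero_add] at this
  have w' : g (w (F.p (-1))) = χ 0 • w (F.p (-1)) := by
    have := map_apply_of_mem_gradeOne hw hχ (F.map_p (-1))
    rwa [neg_add_cancel] at this
  have vp : ∀ {s t : ZMod m}, s ≠ t → F.f s (F.p t) = 0 := fun h => F.f_eq_zero hinj h (F.map_p _)
  have ve : ∀ {s t : ZMod m}, s ≠ t → F.f s (F.e t) = 0 := fun h => F.f_eq_zero hinj h (F.map_e _)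
  have vw2 : ∀ {s : ZMod m}, s ≠ 3 → F.f s (w (F.p 2)) = 0 := fun h => F.f_eq_zero hinj h w2
  have f0 : ∀ v, F.f 0 (F.y₁ w v) = F.f 2 (w (F.p 1)) * F.f 0 v := by
    intro v
    simp [y₁_apply, vw2 n03, vp n01, F.f_e, ve n02, ve n03]
  have f1 : ∀ v, F.f 1 (F.y₁ w v) = F.f 2 (w v) := by
    intro v
    simp [y₁_apply, vw2 n13, F.f_p 1 h1 n12, ve n01.symm, ve n12, ve n13]
  have f2 : ∀ v, F.f 2 (F.y₁ w v) = -(F.f 3 (w (F.p 2)) * F.f 2 v) := by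
    intro v
    simp [y₁_apply, vw2 n23, vp n12.symm, F.f_e, ve n02.symm, ve n23]
  have f3 : ∀ v, F.f 3 (F.y₁ w v) = 0 := by
    intro v
    simp [y₁_apply, vp n13.symm, F.f_e, ve n03.symm, ve n23.symm]
    ring
  have p1 : F.y₁ w (F.p 1) = F.f 2 (w (F.p 1)) • F.p 1 := by
    simp [y₁_apply, vp n13.symm, vp n01, vp n12.symm]
  have p2 : F.y₁ w (F.p 2) = 0 := by
    simp [y₁_apply, vp n23.symm, F.f_p_two, vw2 n23, vp n02]
  have p0 : F.y₁ w (F.p 0) = 0 := by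
    simp [y₁_apply, vp n03.symm, F.f_p_zero, F.f_eq_zero hinj n12.symm w0, vp n02.symm]
  have p' : F.y₁ w (F.p (-1)) =
      F.f 3 (F.p (-1)) • (w (F.p 2) - F.f 3 (w (F.p 2)) • F.e 3) := by
    simp only [y₁_apply, F.f_eq_zero hinj n02.symm w', vp n2', vp n0']
    module
  simp only [α_apply, β_apply, ψ_apply, LieRing.of_associative_ring_bracket,
    Module.End.mul_apply, map_sub, f0, f1, f2, f3, p0, p1, p2, p', map_smul, map_zero, smul_eq_mul]
  ring

variable [NeZero m]

theorem y₀_x (hinj : Function.Injective χ) : ⁅F.y₀, F.x⁆ = 0 := by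
  ext v
  simp [LieRing.of_associative_ring_bracket, y₀, F.f_two_x hinj, F.x_p_two hinj]

theorem lie_y₀_add_lie_y₁ (hm : 4 ≤ m) (hχ : ∀ t, χ (t + 1) = ζ * χ t)
    (hinj : Function.Injective χ) {w : End K V} (hw : w ∈ gradeOne g.lieConj ζ) :
    ⁅F.y₀, w⁆ + ⁅F.y₁ w, F.x⁆ = 0 := by
  obtain ⟨h1, h2, h3⟩ := zmod_one_two_three_ne_zero hm
  have w2 : g (w (F.p 2)) = χ 3 • w (F.p 2) := by
    have := map_apply_of_mem_gradeOne hw hχ (F.map_p 2)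
    rwa [two_add_one_eq_three] at this
  have hx1 := F.x_p hinj 1 h1 (fun h => h1 (by linear_combination -h))
  have he0 := F.x_e hinj 0
  have he2 := F.x_e hinj 2
  have he3 := F.x_e hinj 3
  have hp3 := F.p_eq 3 h3 (fun h => h1 (by linear_combination h))
  rw [one_add_one_eq_two] at hx1
  rw [zero_add] at he0
  rw [two_add_one_eq_three] at he2
  have hf2w : ∀ v, F.f 2 (w (F.x v)) = F.f 0 v * F.f 2 (w (F.p 1)) := by
    intro v
    rw [x_apply, map_sum, map_sum, Finset.sum_eq_single 0]
    · simp
    · intro s _ hs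
      rw [map_smul, map_smul, F.f_eq_zero hinj _ (map_apply_of_mem_gradeOne hw hχ (F.map_p _)),
        smul_zero]
      intro h
      exact hs (by linear_combination -h)
    · simp
  ext v
  simp only [LieRing.of_associative_ring_bracket, LinearMap.add_apply, LinearMap.sub_apply,
    Module.End.mul_apply, y₁_apply, y₀, LinearMap.smulRight_apply, hf2w, F.f_zero_x hinj,
    F.f_two_x hinj, F.f_three_x hm hinj, map_add, map_sub, map_smul, hx1, he0, he2, he3, hp3,
    F.x_of_mem hinj w2, LinearMap.zero_apply]
  module

theorem not_gib [FiniteDimensional K V] [Infinite K] (hm : 4 ≤ m)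
    (hχ : ∀ t, χ (t + 1) = ζ * χ t) (hinj : Function.Injective χ) (F : Frame g χ) :
    ¬ GIB K (gradeZero g.lieConj) (gradeOne g.lieConj ζ) := by
  intro h
  obtain ⟨⟨w₀, hw₀⟩, hfin⟩ := h.finite_setOf_not_liftable ⟨F.x, F.x_mem hχ⟩
  specialize hfin ⟨F.w₁, F.w₁_mem hχ⟩
  obtain ⟨hα, hψ⟩ := F.α_w₁_ψ_w₁ hm hinj
  -- The obstruction along the line `w₀ + c w₁` is a monic cubic polynomial in `c`.
  let P : Polynomial K := (.X + .C (F.α w₀)) *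
    (.X ^ 2 + .C (F.ψ w₀ F.w₁ + F.ψ F.w₁ w₀) * .X + .C (F.ψ w₀ w₀))
  have hP : P.Monic := by
    refine (Polynomial.monic_X_add_C _).mul ?_
    rw [add_assoc]
    refine Polynomial.monic_X_pow_add ?_
    compute_degree!
  obtain ⟨c, hc⟩ := (hfin.union (Polynomial.finite_setOfPred_isRoot hP.ne_zero)).exists_notMem
  simp only [Set.mem_union, Set.mem_ofPred_eq, not_or, not_not] at hc
  obtain ⟨hc, hroot⟩ := hc
  set w : End K V := w₀ + c • F.w₁ with hwdef
  have hw : w ∈ gradeOne g.lieConj ζ :=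
    add_mem hw₀ (SMulMemClass.smul_mem c (F.w₁_mem hχ))
  have hne : F.α w * F.ψ w w ≠ 0 := by
    intro h0
    apply hroot
    refine Eq.trans ?_ h0
    simp only [P, hwdef, Polynomial.eval_mul, Polynomial.eval_add, Polynomial.eval_X,
      Polynomial.eval_C, Polynomial.eval_pow, map_add, map_smul,
      LinearMap.add_apply, LinearMap.smul_apply, smul_eq_mul, hα, hψ]
    ring
  have hmem := hc ⟨F.y₀, F.y₀_mem⟩ ⟨F.y₁ w, F.y₁_mem hχ hw⟩
    (Subtype.ext (F.y₀_x hinj)) (Subtype.ext (F.lie_y₀_add_lie_y₁ hm hχ hinj hw))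
  -- The differential of `α β` at `w` vanishes on `⁅𝔤₀, x⁆ + ⁅(𝔤₀)_x, w⁆`.
  have hle : sliceTangent K (gradeZero g.lieConj) (⟨F.x, F.x_mem hχ⟩ : gradeOne g.lieConj ζ)
      ⟨w, hw⟩ ≤ LinearMap.ker
        ((F.α w • F.β + F.β w • F.α) ∘ₗ (gradeOne g.lieConj ζ).toSubmodule.subtype) := by
    refine sup_le ?_ ?_
    · rintro _ ⟨y, rfl⟩
      change F.α w * F.β ⁅y.1, F.x⁆ + F.β w * F.α ⁅y.1, F.x⁆ = 0
      rw [F.α_lie_x hm hinj, F.β_lie_x hm hinj]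
      ring
    · rintro _ ⟨y, hy, rfl⟩
      have hyx : ⁅y.1, F.x⁆ = 0 := congrArg Subtype.val hy
      obtain ⟨d, hd⟩ := F.exists_α_lie_β_lie hm hinj (mem_gradeZero_lieConj.1 y.2)
        (fun v => sub_eq_zero.1 (LinearMap.congr_fun hyx v))
      change F.α w * F.β ⁅y.1, w⁆ + F.β w * F.α ⁅y.1, w⁆ = 0
      rw [(hd w).1, (hd w).2]
      ring
  have hker : F.α w * F.β ⁅F.y₁ w, w⁆ + F.β w * F.α ⁅F.y₁ w, w⁆ = 0 := hle hmem
  rw [F.obstruction_eq hm hχ hinj hw] at hker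
  exact hne hker

end Frame

/-! ### Existence of frames -/

section Existence

variable {K V : Type*} [Field K] [AddCommGroup V] [Module K V]

/-- When `g ^ m = 1`, averaging over the powers of `g` replaces any linear form by an eigenform
with the same restriction to the eigenspace of `g`. -/
theorem exists_dual_eigen {m : ℕ} (hmK : (m : K) ≠ 0) {g : V ≃ₗ[K] V} (hg : g ^ m = 1) {a : K}
    (ha : a ^ m = 1) (f : Dual K V) :
    ∃ f' : Dual K V, (∀ v, f' (g v) = a * f' v) ∧ ∀ v, g v = a • v → f' v = f v := by
  have hm0 : m ≠ 0 := by rintro rfl; simp at hmK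
  have ha0 : a ≠ 0 := by
    rintro rfl
    rw [zero_pow hm0] at ha
    exact zero_ne_one ha
  refine ⟨(m : K)⁻¹ • ∑ j ∈ Finset.range m, (a⁻¹ ^ j) • (f ∘ₗ ((g ^ j : V ≃ₗ[K] V) : V →ₗ[K] V)),
    fun v => ?_, fun v hv => ?_⟩
  · have hsum : ∑ j ∈ Finset.range m, (a ^ j)⁻¹ * f ((g ^ j) v) =
        ∑ j ∈ Finset.range m, (a ^ (j + 1))⁻¹ * f ((g ^ (j + 1)) v) := by
      have := (Finset.sum_range_succ (fun j => (a ^ j)⁻¹ * f ((g ^ j) v)) m).symm.trans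
        (Finset.sum_range_succ' (fun j => (a ^ j)⁻¹ * f ((g ^ j) v)) m)
      rw [hg, ha, pow_zero, pow_zero] at this
      exact add_right_cancel this
    simp only [LinearMap.smul_apply, LinearMap.sum_apply, LinearMap.comp_apply, smul_eq_mul,
      LinearEquiv.coe_coe, inv_pow]
    rw [hsum, mul_left_comm a, Finset.mul_sum _ _ a]
    congr 1
    refine Finset.sum_congr rfl fun j _ => ?_
    rw [pow_succ g, pow_succ a, LinearEquiv.mul_apply]
    field_simp
  · have hj : ∀ j : ℕ, (g ^ j) v = a ^ j • v := by
      intro j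
      induction j with
      | zero => simp
      | succ j ih => rw [pow_succ', LinearEquiv.mul_apply, ih, map_smul, hv, smul_smul, pow_succ]
    simp only [LinearMap.smul_apply, LinearMap.sum_apply, LinearMap.comp_apply, smul_eq_mul,
      LinearEquiv.coe_coe, hj, map_smul]
    have : ∀ j ∈ Finset.range m, a⁻¹ ^ j * (a ^ j * f v) = f v := by
      intro j _
      rw [← mul_assoc, ← mul_pow, inv_mul_cancel₀ ha0, one_pow, one_mul]
    rw [Finset.sum_congr rfl this, Finset.sum_const, Finset.card_range, nsmul_eq_mul, ← mul_assoc,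
      inv_mul_cancel₀ hmK, one_mul]

theorem exists_dual_pair {v w : V} (h : LinearIndependent K ![v, w]) :
    ∃ f f' : Dual K V, f v = 1 ∧ f w = 0 ∧ f' v = 0 ∧ f' w = 1 := by
  obtain ⟨l, hl⟩ := (Fintype.linearCombination K ![v, w]).exists_leftInverse_of_injective
    (LinearMap.ker_eq_bot.2 (linearIndependent_iff_injective_fintypeLinearCombination.1 h))
  have h0 : l v = Pi.single 0 1 := by
    simpa [Fintype.linearCombination_apply_single] using LinearMap.congr_fun hl (Pi.single 0 1)
  have h1 : l w = Pi.single 1 1 := by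
    simpa [Fintype.linearCombination_apply_single] using LinearMap.congr_fun hl (Pi.single 1 1)
  exact ⟨LinearMap.proj 0 ∘ₗ l, LinearMap.proj 1 ∘ₗ l, by simp [h0], by simp [h1], by simp [h0],
    by simp [h1]⟩

theorem exists_eigen_pair [FiniteDimensional K V] {m : ℕ} (hmK : (m : K) ≠ 0) {g : V ≃ₗ[K] V}
    (hg : g ^ m = 1) {a : K} (ha : a ^ m = 1)
    (hpos : 1 ≤ finrank K (End.eigenspace (g : End K V) a)) :
    ∃ (e e' : V) (f f' : Dual K V), g e = a • e ∧ g e' = a • e' ∧ (∀ v, f (g v) = a * f v) ∧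
      (∀ v, f' (g v) = a * f' v) ∧ f e = 1 ∧
      (2 ≤ finrank K (End.eigenspace (g : End K V) a) → f e' = 0 ∧ f' e = 0 ∧ f' e' = 1) := by
  have hmem : ∀ v : End.eigenspace (g : End K V) a, g v = a • (v : V) := fun v =>
    End.mem_eigenspace_iff.1 v.2
  have : Nontrivial (End.eigenspace (g : End K V) a) := finrank_pos_iff.1 hpos
  obtain ⟨e, he⟩ := exists_ne (0 : End.eigenspace (g : End K V) a)
  by_cases h2 : 2 ≤ finrank K (End.eigenspace (g : End K V) a)
  · obtain ⟨e', hli⟩ := exists_linearIndependent_pair_of_one_lt_finrank h2 he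
    have hli' : LinearIndependent K ![(e : V), (e' : V)] := by
      rw [LinearIndependent.pair_iff] at hli ⊢
      exact fun b₁ b₂ h => hli b₁ b₂ (Subtype.ext h)
    obtain ⟨f, f', h1, h2, h3, h4⟩ := exists_dual_pair hli'
    obtain ⟨φ, hφ, hφ'⟩ := exists_dual_eigen hmK hg ha f
    obtain ⟨ψ, hψ, hψ'⟩ := exists_dual_eigen hmK hg ha f'
    refine ⟨e, e', φ, ψ, hmem e, hmem e', hφ, hψ, ?_, fun _ => ⟨?_, ?_, ?_⟩⟩
    · rw [hφ' _ (hmem e), h1]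
    · rw [hφ' _ (hmem e'), h2]
    · rw [hψ' _ (hmem e), h3]
    · rw [hψ' _ (hmem e'), h4]
  · obtain ⟨f, hf⟩ : ∃ f : Dual K V, f e = 1 := by
      have he' : (e : V) ≠ 0 := fun h => he (Subtype.ext h)
      rw [Ne, ← forall_dual_apply_eq_zero_iff K, not_forall] at he'
      obtain ⟨f, hf⟩ := he'
      exact ⟨(f e)⁻¹ • f, by simp [hf]⟩
    obtain ⟨φ, hφ, hφ'⟩ := exists_dual_eigen hmK hg ha f
    exact ⟨e, e, φ, φ, hmem e, hmem e, hφ, hφ, by rw [hφ' _ (hmem e), hf], fun h => absurd h h2⟩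

theorem nonempty_frame [FiniteDimensional K V] {m : ℕ} (hmK : (m : K) ≠ 0)
    {g : V ≃ₗ[K] V} (hg : g ^ m = 1) {χ : ZMod m → K} (hχ : ∀ t, χ t ^ m = 1)
    (hpos : ∀ t, 1 ≤ finrank K (End.eigenspace (g : End K V) (χ t)))
    (h0 : 2 ≤ finrank K (End.eigenspace (g : End K V) (χ 0)))
    (h1 : 2 ≤ finrank K (End.eigenspace (g : End K V) (χ 1)))
    (h2 : 2 ≤ finrank K (End.eigenspace (g : End K V) (χ 2))) : Nonempty (Frame g χ) := by
  choose e e' f f' he he' hf hf' hfe hpair using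
    fun t => exists_eigen_pair hmK hg (hχ t) (hpos t)
  have ne : ∀ t, e t ≠ 0 := fun t h => by simpa [h] using hfe t
  have ne' : ∀ t, 2 ≤ finrank K (End.eigenspace (g : End K V) (χ t)) → e' t ≠ 0 :=
    fun t ht h => by simpa [h] using (hpair t ht).2.2
  classical
  exact ⟨{
    e := e
    p := fun t => if t = 0 ∨ t = 2 then e' t else e t
    f := f
    b := e' 1
    h₀ := f' 0
    h₁ := f' 1
    map_e := he
    map_p := fun t => by
      split_ifs
      · exact he' t
      · exact he t
    f_map := hf
    map_b := he' 1
    h₀_map := hf' 0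
    h₁_map := hf' 1
    f_e := hfe
    p_eq := fun t h h' => by simp [h, h']
    p_ne := fun t => by
      split_ifs with h
      · obtain rfl | rfl := h
        · exact ne' 0 h0
        · exact ne' 2 h2
      · exact ne t
    f_p_zero := by simpa using (hpair 0 h0).1
    f_p_two := by simpa using (hpair 2 h2).1
    f_b := (hpair 1 h1).1
    h₀_p := by simpa using (hpair 0 h0).2.2
    h₁_b := (hpair 1 h1).2.2
    h₁_e := (hpair 1 h1).2.1 }⟩

/-! ### Rank and multiplicities -/

theorem lieConj_pow_apply (g : V ≃ₗ[K] V) (n : ℕ) (f : End K V) :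
    (g.lieConj.toLinearEquiv ^ n) f = (g ^ n).lieConj f := by
  induction n generalizing f with
  | zero => ext; rfl
  | succ n ih =>
    rw [pow_succ, LinearEquiv.mul_apply, ih, pow_succ]
    ext v
    rfl

/-- If conjugation by `g` has order dividing `m`, then `g ^ m` is central, hence scalar, and `g` can
be rescaled so that `g ^ m = 1`. -/
theorem exists_lieConj_eq_of_pow_eq_one [IsAlgClosed K] {m : ℕ} (hm : 0 < m) {g : V ≃ₗ[K] V}
    (hg : g.lieConj.toLinearEquiv ^ m = 1) :
    ∃ g' : V ≃ₗ[K] V, g.lieConj = g'.lieConj ∧ g' ^ m = 1 := by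
  have hcomm : ∀ f : End K V, ∀ v, (g ^ m) (f v) = f ((g ^ m) v) := by
    intro f
    refine mem_gradeZero_lieConj.1 ?_
    change (g ^ m).lieConj f = f
    rw [← lieConj_pow_apply, hg]
    rfl
  have hcenter : ((g ^ m : V ≃ₗ[K] V) : End K V) ∈ Set.center (End K V) := by
      rw [Semigroup.mem_center_iff]
      intro f
      ext v
      exact (hcomm f v).symm
  obtain ⟨a, _, ha⟩ := Module.End.mem_center_iff.1 hcenter
  have ha' : ∀ v, (g ^ m) v = a • v := fun v => LinearMap.congr_fun ha v
  rcases subsingleton_or_nontrivial V with hV | hV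
  · exact ⟨g, rfl, LinearEquiv.ext fun v => Subsingleton.elim _ _⟩
  have ha0 : a ≠ 0 := by
    rintro rfl
    obtain ⟨v, hv⟩ := exists_ne (0 : V)
    have := ha' v
    rw [zero_smul, LinearEquiv.map_eq_zero_iff] at this
    exact hv this
  obtain ⟨b, hb⟩ := IsAlgClosed.exists_pow_nat_eq a⁻¹ hm
  have hb0 : b ≠ 0 := by
    rintro rfl
    rw [zero_pow hm.ne', eq_comm, inv_eq_zero] at hb
    exact ha0 hb
  let s : V ≃ₗ[K] V := LinearEquiv.smulOfNeZero K V b hb0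
  have hs : ∀ (n : ℕ) (v : V), ((s * g) ^ n) v = b ^ n • (g ^ n) v := by
    intro n
    induction n with
    | zero => intro v; simp
    | succ n ih =>
      intro v
      rw [pow_succ', LinearEquiv.mul_apply, ih, map_smul, pow_succ' g, pow_succ' b, mul_comm b,
        mul_smul]
      rfl
  refine ⟨s * g, ?_, ?_⟩
  · ext f v
    change g (f (g.symm v)) = b • g (f ((s * g).symm v))
    obtain ⟨u, rfl⟩ := (s * g).surjective v
    rw [LinearEquiv.symm_apply_apply]
    change g (f (g.symm (b • g u))) = _
    rw [map_smul, LinearEquiv.symm_apply_apply, map_smul, map_smul]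
  · ext v
    rw [hs, ha', hb, smul_smul, inv_mul_cancel₀ ha0, one_smul]
    rfl

variable {m : ℕ} {ζ : K} {g : V ≃ₗ[K] V}

theorem pow_val_add_one (hm : 1 < m) (hζ : IsPrimitiveRoot ζ m) (t : ZMod m) :
    ζ ^ (t + 1).val = ζ * ζ ^ t.val := by
  have : Fact (1 < m) := ⟨hm⟩
  have : NeZero m := ⟨by omega⟩
  rw [ZMod.val_add, ZMod.val_one, ← pow_succ', ← Nat.mod_add_div (t.val + 1) m, pow_add ζ, pow_mul,
    hζ.pow_eq_one, one_pow, mul_one, Nat.mod_add_div]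

theorem pow_val_injective [NeZero m] (hζ : IsPrimitiveRoot ζ m) :
    Function.Injective fun t : ZMod m => ζ ^ t.val := fun s t h =>
  ZMod.val_injective m (hζ.pow_inj s.val_lt t.val_lt h)

theorem pow_map_of_mem_gradeOne {z : End K V} (hz : z ∈ gradeOne g.lieConj ζ) (j : ℕ) (v : V) :
    g ((z ^ j) v) = ζ ^ j • (z ^ j) (g v) := by
  induction j generalizing v with
  | zero => simp
  | succ j ih =>
    rw [pow_succ', Module.End.mul_apply, mem_gradeOne_lieConj.1 hz, ih, map_smul, smul_smul,
      Module.End.mul_apply, pow_succ']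

variable [FiniteDimensional K V]

/-- A nonzero rank is attained; positivity excludes the junk value `0` of the supremum of the empty
set. -/
theorem exists_isToral_finrank_eq_rank {θ : End K V ≃ₗ⁅K⁆ End K V} (h : 0 < rank θ ζ) :
    ∃ c : Submodule K (End K V), IsToral θ ζ c ∧ finrank K c = rank θ ζ := by
  obtain ⟨c, hc, hd⟩ : rank θ ζ ∈ {d | ∃ c : Submodule K (End K V),
      IsCartanSubspace θ ζ c ∧ finrank K c = d} := by
    refine Nat.sSup_mem ?_ ⟨finrank K (End K V), ?_⟩
    · by_contra hne
      rw [Set.not_nonempty_iff_eq_empty] at hne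
      rw [rank, hne, csSup_empty] at h
      exact h.ne rfl
    · rintro _ ⟨c, _, rfl⟩
      exact c.finrank_le
  exact ⟨c, hc.prop, hd⟩

variable [IsAlgClosed K]

/-- For a nonzero semisimple `z ∈ 𝔤₁`, the power `z ^ m` has an eigenvector with nonzero eigenvalue
in every eigenspace of `g`, since `z` carries such eigenvectors from one eigenspace to the next. -/
theorem exists_eigenvector_of_isSemisimple [NeZero m] (hζ : IsPrimitiveRoot ζ m) (hg : g ^ m = 1)
    {z : End K V} (hz : z ∈ gradeOne g.lieConj ζ) (hss : z.IsSemisimple) (hz0 : z ≠ 0) {a : K}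
    (ha : a ^ m = 1) :
    ∃ u : V, u ≠ 0 ∧ g u = a • u ∧ ∃ ν : K, ν ≠ 0 ∧ (z ^ m) u = ν • u := by
  obtain ⟨l, hl, hl0⟩ : ∃ l : K, z.HasEigenvalue l ∧ l ≠ 0 := by
    by_contra! h
    exact hz0 (hss.eq_zero_iff_forall_eigenvalue.2 h)
  obtain ⟨v, hv⟩ := hl.exists_hasEigenvector
  -- `z ^ m` has degree zero, so its eigenspace `W` is stable under `g` and contains an eigenvector
  -- `u` of `g`; a power of `z` moves `u` to the required eigenspace.
  set W := End.eigenspace (z ^ m) (l ^ m) with hW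
  have hvW : v ∈ W := End.mem_eigenspace_iff.2 (hv.pow_apply m)
  have hgW : ∀ w ∈ W, (g : End K V) w ∈ W := by
    intro w hw
    have h := pow_map_of_mem_gradeOne hz m w
    rw [End.mem_eigenspace_iff.1 hw, hζ.pow_eq_one, one_smul, map_smul] at h
    exact End.mem_eigenspace_iff.2 h.symm
  have : Nontrivial W := ⟨⟨v, hvW⟩, 0, fun h => hv.2 (congrArg Subtype.val h)⟩
  obtain ⟨μ, hμ⟩ := End.exists_eigenvalue ((g : End K V).restrict hgW)
  obtain ⟨⟨u, huW⟩, hu⟩ := hμ.exists_hasEigenvector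
  have hu0 : u ≠ 0 := fun h => hu.2 (Subtype.ext h)
  have hgu : g u = μ • u := congrArg Subtype.val hu.apply_eq_smul
  have hμm : μ ^ m = 1 := by
    have hpow : ∀ j : ℕ, (g ^ j) u = μ ^ j • u := by
      intro j
      induction j with
      | zero => simp
      | succ j ih => rw [pow_succ', LinearEquiv.mul_apply, ih, map_smul, hgu, smul_smul, pow_succ]
    have h := hpow m
    rw [hg, LinearEquiv.coe_one, id] at h
    by_contra hne
    have h' : (μ ^ m - 1) • u = 0 := by rw [sub_smul, ← h, one_smul, sub_self]
    exact (smul_eq_zero.1 h').elim (fun h => hne (sub_eq_zero.1 h)) hu0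
  have hμ0 : μ ≠ 0 := by
    rintro rfl
    rw [zero_pow (NeZero.ne m)] at hμm
    exact zero_ne_one hμm
  obtain ⟨j, hj, hja⟩ := hζ.eq_pow_of_pow_eq_one
    (show (a * μ⁻¹) ^ m = 1 by rw [mul_pow, ha, inv_pow, hμm, inv_one, mul_one])
  have hzu : (z ^ m) u = l ^ m • u := End.mem_eigenspace_iff.1 huW
  refine ⟨(z ^ j) u, fun h => ?_, ?_, l ^ m, pow_ne_zero _ hl0, ?_⟩
  · have h' : (z ^ m) u = 0 := by
      rw [← Nat.sub_add_cancel hj.le, pow_add, Module.End.mul_apply, h, map_zero]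
    rw [hzu] at h'
    exact (smul_eq_zero.1 h').elim (pow_ne_zero _ hl0) hu0
  · rw [pow_map_of_mem_gradeOne hz, hgu, map_smul, smul_smul, hja, mul_assoc,
      inv_mul_cancel₀ hμ0, mul_one]
  · rw [← Module.End.mul_apply, ← pow_add, add_comm, pow_add, Module.End.mul_apply, hzu, map_smul]

theorem one_le_finrank_eigenspace [NeZero m] (hζ : IsPrimitiveRoot ζ m) (hg : g ^ m = 1)
    (h : 0 < rank g.lieConj ζ) {a : K} (ha : a ^ m = 1) :
    1 ≤ finrank K (End.eigenspace (g : End K V) a) := by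
  obtain ⟨c, ⟨h1, h2, -⟩, hd⟩ := exists_isToral_finrank_eq_rank h
  have : Nontrivial c := finrank_pos_iff.1 (hd ▸ h)
  obtain ⟨⟨z, hz⟩, hz0⟩ := exists_ne (0 : c)
  obtain ⟨u, hu0, hu, -⟩ := exists_eigenvector_of_isSemisimple hζ hg (h1 z hz) (h2 z hz)
    (fun h => hz0 (Subtype.ext h)) ha
  exact finrank_pos_iff.2 ⟨⟨u, End.mem_eigenspace_iff.2 hu⟩, 0,
    fun h => hu0 (congrArg Subtype.val h)⟩

/-- If two independent commuting semisimple elements of `𝔤₁` exist, no eigenspace of `g` is a line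
`K u`: a combination of the two elements would kill `u`, contradicting
`exists_eigenvector_of_isSemisimple` for this combination. -/
theorem two_le_finrank_eigenspace [NeZero m] (hζ : IsPrimitiveRoot ζ m) (hg : g ^ m = 1)
    (h : 1 < rank g.lieConj ζ) {a : K} (ha : a ^ m = 1) :
    2 ≤ finrank K (End.eigenspace (g : End K V) a) := by
  obtain ⟨c, ⟨h1, h2, h3⟩, hd⟩ := exists_isToral_finrank_eq_rank (zero_lt_one.trans h)
  have h1c : 1 < finrank K c := hd ▸ h
  have : Nontrivial c := finrank_pos_iff.1 (zero_lt_one.trans h1c)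
  obtain ⟨⟨z, hz⟩, hz0⟩ := exists_ne (0 : c)
  obtain ⟨⟨y, hy⟩, hli⟩ := exists_linearIndependent_pair_of_one_lt_finrank h1c hz0
  obtain ⟨u, hu0, hu, ν, hν, hzu⟩ := exists_eigenvector_of_isSemisimple hζ hg (h1 z hz) (h2 z hz)
    (fun h => hz0 (Subtype.ext h)) ha
  by_contra hlt
  have hle : finrank K (End.eigenspace (g : End K V) a) ≤ 1 := by omega
  have hspan : ∀ v, g v = a • v → ∃ b : K, v = b • u := by
    intro v hv
    obtain ⟨e, he⟩ := finrank_le_one_iff.1 hle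
    obtain ⟨b₁, hb₁⟩ := he ⟨u, End.mem_eigenspace_iff.2 hu⟩
    obtain ⟨b₂, hb₂⟩ := he ⟨v, End.mem_eigenspace_iff.2 hv⟩
    have hb₁' : b₁ • (e : V) = u := congrArg Subtype.val hb₁
    have hb₂' : b₂ • (e : V) = v := congrArg Subtype.val hb₂
    have hb0 : b₁ ≠ 0 := by
      rintro rfl
      exact hu0 (by rw [← hb₁', zero_smul])
    exact ⟨b₂ * b₁⁻¹, by rw [← hb₁', smul_smul, mul_assoc, inv_mul_cancel₀ hb0, mul_one, hb₂']⟩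
  obtain ⟨b, hb⟩ := hspan (y ((z ^ (m - 1)) u)) (by
    rw [mem_gradeOne_lieConj.1 (h1 y hy), pow_map_of_mem_gradeOne (h1 z hz), hu, map_smul, map_smul,
      map_smul, smul_smul, smul_smul, ← pow_succ',
      Nat.sub_add_cancel (NeZero.pos m), hζ.pow_eq_one, one_mul])
  -- The combination `y'` kills `z ^ (m - 1) u`, hence also its image `ν u` under `z`.
  set y' : End K V := y - (b * ν⁻¹) • z with hy'
  have hy'c : y' ∈ c := c.sub_mem hy (c.smul_mem _ hz)
  have hy'0 : y' ≠ 0 := by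
    intro h0
    have := LinearIndependent.pair_iff.1 hli (-(b * ν⁻¹)) 1 (Subtype.ext (by
      change -(b * ν⁻¹) • z + (1 : K) • y = 0
      rw [← h0, hy']
      module))
    exact one_ne_zero this.2
  have hcomm : y' * z = z * y' := sub_eq_zero.1 (h3 y' hy'c z hz)
  have hzu' : z ((z ^ (m - 1)) u) = ν • u := by
    rw [← hzu, ← Module.End.mul_apply, ← pow_succ', Nat.sub_add_cancel (NeZero.pos m)]
  have hker : y' ((z ^ (m - 1)) u) = 0 := by
    rw [hy', LinearMap.sub_apply, LinearMap.smul_apply, hb, hzu', smul_smul, mul_assoc,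
      inv_mul_cancel₀ hν, mul_one, sub_self]
  have hy'u : y' u = 0 := by
    have : ν • y' u = 0 := by
      rw [← map_smul, ← hzu', ← Module.End.mul_apply, hcomm, Module.End.mul_apply, hker, map_zero]
    exact (smul_eq_zero.1 this).resolve_left hν
  obtain ⟨u', hu'0, hu', ν', hν', hyu'⟩ := exists_eigenvector_of_isSemisimple hζ hg (h1 y' hy'c)
    (h2 y' hy'c) hy'0 ha
  obtain ⟨d, rfl⟩ := hspan u' hu'
  rw [← Nat.sub_add_cancel (NeZero.pos m), pow_succ, Module.End.mul_apply, map_smul, hy'u,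
    smul_zero, map_zero] at hyu'
  exact (smul_eq_zero.1 hyu'.symm).elim hν' hu'0

end Existence

end ThetaRep

theorem mainTheorem3 {F : Type*} [Field F] [IsAlgClosed F] [CharZero F]
    {V : Type*} [AddCommGroup V] [Module F V] [FiniteDimensional F V]
    {m : ℕ} (hm : 4 ≤ m) {ζ : F} (hζ : IsPrimitiveRoot ζ m)
    (θ : Module.End F V ≃ₗ⁅F⁆ Module.End F V) (hθ : ThetaRep.IsInner θ)
    (hord : orderOf θ.toLinearEquiv = m)
    (h : 1 < ThetaRep.rank θ ζ ∨
      (ThetaRep.rank θ ζ = 1 ∧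
        ∃ r : ZMod m → ℕ, ThetaRep.IsMultiplicitiesVector θ ζ m r ∧
          ∃ i : ZMod m, 2 ≤ r i ∧ 2 ≤ r (i + 1) ∧ 2 ≤ r (i + 2))) :
    ¬ ThetaRep.GIB F (ThetaRep.gradeZero θ) (ThetaRep.gradeOne θ ζ) := by
  have : NeZero m := ⟨by omega⟩
  have hmF : (m : F) ≠ 0 := Nat.cast_ne_zero.2 (NeZero.ne m)
  have hroot : ∀ n : ℕ, (ζ ^ n) ^ m = 1 := fun n => by
    rw [← pow_mul, mul_comm, pow_mul, hζ.pow_eq_one, one_pow]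
  obtain ⟨g, rfl, hg, i, h0, h1, h2⟩ : ∃ g : V ≃ₗ[F] V, θ = g.lieConj ∧ g ^ m = 1 ∧ ∃ i : ZMod m,
      2 ≤ Module.finrank F (Module.End.eigenspace (g : Module.End F V) (ζ ^ i.val)) ∧
      2 ≤ Module.finrank F (Module.End.eigenspace (g : Module.End F V) (ζ ^ (i + 1).val)) ∧
      2 ≤ Module.finrank F (Module.End.eigenspace (g : Module.End F V) (ζ ^ (i + 2).val)) := by
    rcases h with h | ⟨-, r, ⟨g, hθg, hg, hr⟩, i, h0, h1, h2⟩
    · obtain ⟨g, rfl⟩ := hθ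
      obtain ⟨g', hg', hpow⟩ := ThetaRep.exists_lieConj_eq_of_pow_eq_one (m := m) (by omega)
        (hord ▸ pow_orderOf_eq_one _)
      rw [hg'] at h
      have key := fun n => ThetaRep.two_le_finrank_eigenspace hζ hpow h (hroot n)
      exact ⟨g', hg', hpow, 0, key _, key _, key _⟩
    · exact ⟨g, hθg, hg, i, hr i ▸ h0, hr (i + 1) ▸ h1, hr (i + 2) ▸ h2⟩
  have hrank : 0 < ThetaRep.rank g.lieConj ζ := by
    rcases h with h | ⟨h, -⟩ <;> omega
  -- Shifting the indices by `i` moves the three large eigenspaces to degrees `0`, `1`, `2`.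
  obtain ⟨D⟩ := ThetaRep.nonempty_frame (χ := fun t => ζ ^ (i + t).val) hmF hg
    (fun t => hroot _)
    (fun t => ThetaRep.one_le_finrank_eigenspace hζ hg hrank (hroot _))
    (by rw [add_zero]; exact h0) h1 h2
  exact D.not_gib hm (fun t => by
      simpa only [add_assoc] using ThetaRep.pow_val_add_one (by omega) hζ (i + t))
    (fun s t hst => add_left_cancel (ThetaRep.pow_val_injective hζ hst))
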